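/- Theorem 1.4. Let $p$ be an odd prime and let $k$ be an integer with $2\le k\le \frac{p-1}{2}$ and $p\equiv 1 \pmod{2k}$. Let $\alpha_1,\dots,\alpha_{(p-1)/k}$ be integers prime to $p$, pairwise incongruent modulo $p$, each congruent modulo $p$ to a $k$-th power (so they represent all $k$-th power residues modulo $p$). Let $\left(\frac{\cdot}{p}\right)$ be the Legendre symbol, let $a!!=a(a-2)(a-4)\cdots$ (ending in $2$ or $1$) for a positive integer $a$, and put $$S=S_{3+\frac{p-1}{k},k}(-1,p)=\det\left[(\alpha_i-\alpha_j)^{3+\frac{p-1}{k}}\right]_{1\le i,j\le \frac{p-1}{k}},\qquad T=\prod_{1\le i<j\le \frac{p-1}{k}}(\alpha_i-\alpha_j).$$ Then $S$ is the square of an integer, and its nonnegative square root $\sqrt S$ satisfies the following. (a) If $p\equiv 1\pmod{4k}$, then $$\left(\frac{\sqrt S}{p}\right)=\left(\frac{k(3k-1)(4k-1)\left(6k^3+(3k-1)(2k-1)(k-1)\right)}{p}\right)\left(\frac{\left(\frac{p-1}{k}-1\right)!!}{p}\right)\left(\frac{T}{p}\right).$$ (b) If $k$ is even and $p\equiv 2k+1\pmod{4k}$,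 then $$\left(\frac{\sqrt S}{p}\right)=\begin{cases}\left(\frac{T}{p}\right), & \text{if } p=2k+1;\\[4pt] \left(\frac{(k-1)(2k-1)(4k-1)\left(6k^3+(3k-1)(2k-1)(k-1)\right)}{p}\right)\left(\frac{\frac{p-1}{k}!!}{p}\right)\left(\frac{T}{p}\right), & \text{otherwise.}\end{cases}$$ -/

import Mathlib

/-- `a` is a `k`-th power residue modulo `p`: it is prime to `p` and congruent to a `k`-th power. -/
def IsPowerResidue (k p : ℕ) (a : ℤ) : Prop :=
  IsCoprime a (p : ℤ) ∧ ∃ x : ℤ, x ^ k ≡ a [ZMOD (p : ℤ)]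

/-- `α` lists integers that are `k`-th power residues modulo `p`, pairwise incongruent modulo `p`.
With `(p - 1) / k` entries, where `k ∣ p - 1`, it represents every residue class of this kind
exactly once. -/
def IsResidueSystem (k p : ℕ) (α : Fin ((p - 1) / k) → ℤ) : Prop :=
  (∀ i, IsPowerResidue k p (α i)) ∧ ∀ i j, α i ≡ α j [ZMOD (p : ℤ)] → i = j

/-- The integer determinant `S_{n,k}(d,p) = |(α_i + d α_j)^n|`, `1 ≤ i, j ≤ (p - 1) / k`. -/
def residueDet (n k : ℕ) (d : ℤ) (p : ℕ) (α : Fin ((p - 1) / k) → ℤ) : ℤ :=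
  Matrix.det (Matrix.of fun i j => (α i + d * α j) ^ n)

/-- `T((p - 1) / k) = ∏_{i < j} (α_i - α_j)`. -/
def residueDiffProd (k p : ℕ) (α : Fin ((p - 1) / k) → ℤ) : ℤ :=
  ∏ i, ∏ j ∈ Finset.Ioi i, (α i - α j)

/-! Put n = (p-1)/k, which is even. The exponent n+3 is odd, so the matrix is skew-symmetric and S
is a square over ℤ. Modulo p the α_i are n-th roots of unity. Reducing exponents mod n in
(x-y)^(n+3) factors the matrix as D V C J Vᵀ D, with D and C diagonal, V Vandermonde and J a signed
antidiagonal of determinant 1 (`sub_pow_add_three_of_pow_eq_one`, `det_sub_pow_add_three`). The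
entries of C are symmetric under a ↦ n-1-a, so √S ≡ ± (∏ α_i)² T ∏_{a<n/2} C_a. In both cases -1 is
a square mod p, so the sign is harmless. What remains is the character of the half product: all but
two factors are plain binomials, and modulo squares these reduce to factorials. The relation kn ≡ -1
turns n+j into (jk-1)/k. -/

/-! ### Determinants of skew-symmetric matrices -/

open Matrix in
/-- The determinant of a skew-symmetric matrix over a field of characteristic different from two
is a square. -/
theorem isSquare_det_of_transpose_eq_neg {K : Type*} [Field K] (h2 : (2 : K) ≠ 0) :
    ∀ (n : ℕ) (A : Matrix (Fin n) (Fin n) K), Aᵀ = -A → IsSquare A.det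
  | 0, A, _ => ⟨1, by simp⟩
  | 1, A, hA => by
    have h : A 0 0 = -A 0 0 := congrFun (congrFun hA 0) 0
    have h0 : A 0 0 = 0 := by
      have : (2 : K) * A 0 0 = 0 := by linear_combination h
      exact (mul_eq_zero.mp this).resolve_left h2
    exact ⟨0, by simp [h0]⟩
  | n + 2, A, hA => by
    have hskew : ∀ i j, A i j = -A j i := fun i j => congrFun (congrFun hA j) i
    have hdiag : ∀ i, A i i = 0 := fun i => by
      have : (2 : K) * A i i = 0 := by linear_combination hskew i i
      exact (mul_eq_zero.mp this).resolve_left h2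
    by_cases hz : ∃ i j, A i j ≠ 0
    swap
    · push Not at hz
      have : A = 0 := by ext i j; exact hz i j
      exact ⟨0, by rw [this, det_zero, mul_zero]⟩
    obtain ⟨i, j, hij⟩ := hz
    have hne : i ≠ j := fun h => hij (h ▸ hdiag i)
    let σ : Equiv.Perm (Fin (n + 2)) := Equiv.swap 0 i * Equiv.swap 1 (Equiv.swap 0 i j)
    have hσ1 : σ 1 = j := by simp [σ]
    have hσ0 : σ 0 = i := by
      have h : (0 : Fin (n + 2)) ≠ Equiv.swap 0 i j := by
        intro h
        have := congrArg (Equiv.swap 0 i) h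
        simp at this
        exact hne this
      simp only [σ, Equiv.Perm.mul_apply]
      rw [Equiv.swap_apply_of_ne_of_ne (by simp) h, Equiv.swap_apply_left]
    let e : Fin 2 ⊕ Fin n ≃ Fin (n + 2) :=
      (finSumFinEquiv.trans (finCongr (Nat.add_comm 2 n))).trans σ
    have he0 : e (Sum.inl 0) = i := by rw [← hσ0]; rfl
    have he1 : e (Sum.inl 1) = j := by rw [← hσ1]; rfl
    rw [← det_submatrix_equiv_self e A, ← fromBlocks_toBlocks (A.submatrix e e)]
    set M := A.submatrix e e with hM
    have hMs : ∀ a b, M a b = -M b a := fun a b => hskew _ _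
    have hP : M.toBlocks₁₁ = !![0, A i j; -A i j, 0] := by
      ext a b
      fin_cases a <;> fin_cases b <;> simp [toBlocks₁₁, hM, he0, he1, hdiag, ← hskew]
    have hdetP : M.toBlocks₁₁.det = A i j * A i j := by rw [hP, det_fin_two_of]; ring
    have hunit : IsUnit M.toBlocks₁₁.det := by
      rw [hdetP]; exact (mul_ne_zero hij hij).isUnit
    let _ : Invertible M.toBlocks₁₁ := invertibleOfIsUnitDet _ hunit
    -- The pivot block has determinant (A i j)², and its Schur complement is again skew-symmetric.
    rw [det_fromBlocks₁₁, hdetP]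
    refine IsSquare.mul ⟨_, rfl⟩ (isSquare_det_of_transpose_eq_neg h2 n _ ?_)
    have t11 : M.toBlocks₁₁ᵀ = -M.toBlocks₁₁ := by ext a b; exact hMs _ _
    have t12 : M.toBlocks₁₂ᵀ = -M.toBlocks₂₁ := by ext a b; exact hMs _ _
    have t21 : M.toBlocks₂₁ᵀ = -M.toBlocks₁₂ := by ext a b; exact hMs _ _
    have t22 : M.toBlocks₂₂ᵀ = -M.toBlocks₂₂ := by ext a b; exact hMs _ _
    have tinv : (⅟M.toBlocks₁₁)ᵀ = -⅟M.toBlocks₁₁ := by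
      rw [invOf_eq_nonsing_inv, transpose_nonsing_inv, t11]
      exact inv_eq_left_inv (by rw [neg_mul_neg]; exact nonsing_inv_mul _ hunit)
    rw [transpose_sub, transpose_mul, transpose_mul, t12, t21, t22, tinv]
    simp only [Matrix.neg_mul, Matrix.mul_neg, neg_neg, Matrix.mul_assoc]
    abel

-- An integer that is a square in ℚ is a square in ℤ.
open Matrix in
theorem Int.isSquare_det_of_transpose_eq_neg {n : ℕ} (A : Matrix (Fin n) (Fin n) ℤ)
    (hA : Aᵀ = -A) : IsSquare A.det := by
  rw [← Rat.isSquare_intCast_iff, Int.cast_det]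
  refine _root_.isSquare_det_of_transpose_eq_neg two_ne_zero n _ ?_
  ext i j
  have := congrFun (congrFun hA i) j
  simp only [transpose_apply, neg_apply] at this
  simp [this]

/-! ### The signed antidiagonal -/

/-- The antidiagonal matrix with alternating signs. -/
def altAntidiagonal (n : ℕ) : Matrix (Fin n) (Fin n) ℤ :=
  Matrix.of fun a b => if b = a.rev then (-1) ^ (a.val + 1) else 0

theorem neg_one_pow_rev_add_one {n : ℕ} (hn : Even n) (a : Fin n) :
    (-1 : ℤ) ^ (a.rev.val + 1) = -(-1) ^ (a.val + 1) := by
  have h : (-1 : ℤ) ^ (a.rev.val + 1) * (-1) ^ a.val = 1 := by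
    rw [← pow_add, Fin.val_rev, show n - (a.val + 1) + 1 + a.val = n by omega, hn.neg_one_pow]
  rcases neg_one_pow_eq_or ℤ a.val with h' | h' <;> rw [pow_succ _ a.val] <;> rw [h'] at h ⊢ <;>
    linarith

-- Skew-symmetry makes the determinant a square, hence nonnegative, and J² = -1 in even size makes
-- it ±1; the sign of the reversal permutation is never computed.
open Matrix in
theorem det_altAntidiagonal {n : ℕ} (hn : Even n) : (altAntidiagonal n).det = 1 := by
  have hs : IsSquare (altAntidiagonal n).det := by
    refine Int.isSquare_det_of_transpose_eq_neg _ ?_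
    ext a b
    simp only [altAntidiagonal, transpose_apply, neg_apply, of_apply]
    by_cases h : b = a.rev
    · subst h
      rw [if_pos (by simp), if_pos rfl, neg_one_pow_rev_add_one hn]
    · rw [if_neg (by rintro rfl; simp at h), if_neg h, neg_zero]
  have hsq : altAntidiagonal n * altAntidiagonal n = -1 := by
    ext a b
    simp only [altAntidiagonal, mul_apply, of_apply, ite_mul, zero_mul, Finset.sum_ite_eq',
      Finset.mem_univ, if_true, Fin.rev_rev, neg_apply, one_apply]
    by_cases h : b = a
    · subst h
      rw [if_pos rfl, if_pos rfl, neg_one_pow_rev_add_one hn, mul_neg, ← mul_pow]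
      norm_num
    · rw [if_neg h, if_neg (Ne.symm h), mul_zero, neg_zero]
  have hd : (altAntidiagonal n).det * (altAntidiagonal n).det = 1 := by
    rw [← det_mul, hsq, det_neg, det_one, Fintype.card_fin, hn.neg_one_pow, one_mul]
  obtain ⟨r, hr⟩ := hs
  have : 0 ≤ (altAntidiagonal n).det := hr ▸ mul_self_nonneg r
  nlinarith

/-! ### Folded binomial coefficients and the factorization -/

/-- The coefficient, up to sign, of `x ^ (a + 2) * y ^ (n + 1 - a)` in the expansion of
`(x - y) ^ (n + 3)` once exponents are reduced modulo `n`. -/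
def foldedChoose (n a : ℕ) : ℕ :=
  (n + 3).choose (a + 2) + (n + 3).choose (n + a + 2) + (n + 3).choose (2 * n + 1 - a)

/-- Binomial symmetry fixes the first term, and the reflection swaps the other two. -/
theorem foldedChoose_reflect {n a : ℕ} (ha : a < n) :
    foldedChoose n (n - 1 - a) = foldedChoose n a := by
  unfold foldedChoose
  rw [← Nat.choose_symm_of_eq_add (show n + 3 = (n - 1 - a + 2) + (a + 2) by omega),
    show n + (n - 1 - a) + 2 = 2 * n + 1 - a by omega,
    show 2 * n + 1 - (n - 1 - a) = n + a + 2 by omega]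
  ring

theorem prod_range_foldedChoose (h : ℕ) :
    ∏ a ∈ Finset.range (2 * h), foldedChoose (2 * h) a =
      (∏ a ∈ Finset.range h, foldedChoose (2 * h) a) ^ 2 := by
  rw [two_mul h, Finset.prod_range_add, sq]
  congr 1
  rw [← Finset.prod_range_reflect]
  refine Finset.prod_congr rfl fun a ha => ?_
  rw [Finset.mem_range] at ha
  rw [← foldedChoose_reflect (n := h + h) (a := a) (by omega)]
  congr 1
  omega

/-- The powers of x congruent to a+2 mod n are a+2, n+a+2 and a+2-n. The last one enters through the
symmetric index 2n+1-a, which avoids truncated subtraction. As n is even, folding preserves signs.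
-/
theorem sub_pow_add_three_of_pow_eq_one {R : Type*} [CommRing R] {n : ℕ} (hn : Even n)
    (hpos : 0 < n) {x y : R} (hx : x ^ n = 1) (hy : y ^ n = 1) :
    (x - y) ^ (n + 3) = x ^ 2 * y ^ 2 *
      ∑ a ∈ Finset.range n, (-1) ^ (a + 1) * (foldedChoose n a : R) * x ^ a * y ^ (n - 1 - a) := by
  obtain ⟨m, rfl⟩ : ∃ m, n = m + 2 := by
    obtain ⟨r, rfl⟩ := hn
    exact ⟨r + r - 2, by omega⟩
  have hm : Even m := by simpa [Nat.even_add] using hn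
  have s1 : ∑ a ∈ Finset.range (m + 2), (-1) ^ (a + 1) * (((m + 5).choose (m + 2 + a + 2) : ℕ) : R)
      * x ^ a * y ^ (m + 1 - a) = -((m + 5 : ℕ) : R) * y ^ (m + 1) + x * y ^ m := by
    rw [Finset.sum_range_succ', Finset.sum_range_succ', Finset.sum_eq_zero]
    · rw [show m + 2 + 0 + 2 = m + 4 by ring, show m + 2 + (0 + 1) + 2 = m + 5 by ring,
        Nat.choose_self, Nat.choose_succ_self_right]
      simp
      ring
    · intro a _
      rw [Nat.choose_eq_zero_of_lt (by omega)]
      simp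
  have s2 : ∑ a ∈ Finset.range (m + 2), (-1) ^ (a + 1) *
      (((m + 5).choose (2 * (m + 2) + 1 - a) : ℕ) : R)
      * x ^ a * y ^ (m + 1 - a) = -x ^ m * y + ((m + 5 : ℕ) : R) * x ^ (m + 1) := by
    rw [Finset.sum_range_succ, Finset.sum_range_succ, Finset.sum_eq_zero]
    · rw [show 2 * (m + 2) + 1 - m = m + 5 by omega,
        show 2 * (m + 2) + 1 - (m + 1) = m + 4 by omega,
        Nat.choose_self, Nat.choose_succ_self_right, pow_succ (-1 : R) (m + 1),
        pow_succ (-1 : R) m, hm.neg_one_pow, Nat.sub_self, Nat.add_sub_cancel_left]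
      push_cast
      ring
    · intro a ha
      rw [Finset.mem_range] at ha
      rw [Nat.choose_eq_zero_of_lt (by omega)]
      simp
  have s3 : x ^ 2 * y ^ 2 * ∑ a ∈ Finset.range (m + 2), (-1) ^ (a + 1) *
      (((m + 5).choose (a + 2) : ℕ) : R) * x ^ a * y ^ (m + 1 - a) =
      ∑ a ∈ Finset.range (m + 2),
        x ^ (a + 2) * (-y) ^ (m + 5 - (a + 2)) * (((m + 5).choose (a + 2) : ℕ) : R) := by
    rw [Finset.mul_sum]
    refine Finset.sum_congr rfl fun a ha => ?_
    rw [Finset.mem_range] at ha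
    obtain ⟨b, hb⟩ : ∃ b, m + 1 = a + b := ⟨m + 1 - a, by omega⟩
    rw [show m + 5 - (a + 2) = b + 2 by omega, show m + 1 - a = b by omega, neg_pow y (b + 2)]
    have hs : (-1 : R) ^ (b + 2) = (-1) ^ (a + 1) := by
      have h1 : (-1 : R) ^ (a + 1) * (-1) ^ (b + 2) = 1 := by
        rw [← pow_add, show a + 1 + (b + 2) = (m + 2) + 2 by omega, pow_add, hn.neg_one_pow]
        simp
      rcases neg_one_pow_eq_or R (a + 1) with h' | h' <;> rw [h'] at h1 ⊢
      · linear_combination h1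
      · linear_combination -h1
    rw [hs]
    ring
  have hsplit : ∑ a ∈ Finset.range (m + 2),
      (-1) ^ (a + 1) * (foldedChoose (m + 2) a : R) * x ^ a * y ^ (m + 2 - 1 - a) =
      ∑ a ∈ Finset.range (m + 2), (-1) ^ (a + 1) * (((m + 5).choose (a + 2) : ℕ) : R) * x ^ a *
        y ^ (m + 1 - a) + (-((m + 5 : ℕ) : R) * y ^ (m + 1) + x * y ^ m) +
        (-x ^ m * y + ((m + 5 : ℕ) : R) * x ^ (m + 1)) := by
    rw [← s1, ← s2, ← Finset.sum_add_distrib, ← Finset.sum_add_distrib]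
    refine Finset.sum_congr rfl fun a _ => ?_
    rw [foldedChoose, show m + 2 - 1 = m + 1 by omega, show m + 2 + 3 = m + 5 by ring]
    push_cast
    ring
  rw [hsplit, mul_add, mul_add, s3]
  rw [sub_eq_add_neg, add_pow, show m + 2 + 3 = m + 5 by ring, Finset.sum_range_succ,
    Finset.sum_range_succ, Finset.sum_range_succ', Finset.sum_range_succ']
  have o4 : (-y) ^ (m + 4) = y ^ (m + 4) :=
    Even.neg_pow (by rw [show m + 4 = m + 2 + 2 by ring]; exact hn.add even_two) y
  have o5 : (-y) ^ (m + 5) = -y ^ (m + 5) := by rw [pow_succ, o4]; ring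
  rw [show m + 5 - (0 + 1) = m + 4 by omega, show m + 5 - 0 = m + 5 by omega,
    show m + 5 - (m + 4) = 1 by omega, Nat.sub_self, o4, o5, Nat.choose_self,
    Nat.choose_succ_self_right (m + 4), zero_add, Nat.choose_one_right, Nat.choose_zero_right]
  push_cast
  -- Only the four end terms of the expansion need folding.
  linear_combination (-y ^ 3 + (m + 5) * x * y ^ 2) * hy - (m + 5) * x * y ^ 2 * hx +
    (y ^ 3 - (m + 5) * x ^ 2 * y + x ^ 3) * hx - (x ^ 3 - (m + 5) * x ^ 2 * y) * hy

open Matrix in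
/-- If the `x i` are `n`-th roots of unity with `n` even, then the determinant of
`(x i - x j) ^ (n + 3)` is an explicit square. -/
theorem det_sub_pow_add_three {R : Type*} [CommRing R] {n h : ℕ} (hn : n = 2 * h)
    (x : Fin n → R) (hx : ∀ i, x i ^ n = 1) :
    (Matrix.of fun i j => (x i - x j) ^ (n + 3)).det =
      ((∏ i, x i ^ 2) * (∏ i, ∏ j ∈ Finset.Ioi i, (x i - x j)) *
        ((∏ a ∈ Finset.range h, foldedChoose n a : ℕ) : R)) ^ 2 := by
  have heven : Even n := ⟨h, by omega⟩
  have hmat : (Matrix.of fun i j => (x i - x j) ^ (n + 3)) =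
      diagonal (fun i => x i ^ 2) * (vandermonde x *
        (diagonal (fun a : Fin n => (foldedChoose n a : R)) *
          (altAntidiagonal n).map (Int.castRingHom R)) * (vandermonde x)ᵀ) *
        diagonal (fun i => x i ^ 2) := by
    ext i j
    rw [mul_diagonal, diagonal_mul, of_apply,
      sub_pow_add_three_of_pow_eq_one heven (Fin.pos i) (hx i) (hx j), mul_apply]
    simp only [mul_apply (M := vandermonde x), diagonal_mul, transpose_apply, vandermonde_apply,
      map_apply, altAntidiagonal, of_apply]
    rw [← Fin.sum_univ_eq_sum_range
      (fun a => (-1) ^ (a + 1) * (foldedChoose n a : R) * x i ^ a * x j ^ (n - 1 - a)) n]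
    simp only [Finset.sum_mul]
    rw [Finset.sum_comm, mul_right_comm]
    congr 2
    refine Finset.sum_congr rfl fun a _ => ?_
    rw [Finset.sum_eq_single a.rev]
    · rw [if_pos rfl, Fin.val_rev, show n - (a.val + 1) = n - 1 - a.val by omega]
      simp
      ring
    · intro b _ hb
      simp [hb]
    · simp
  -- The Vandermonde factors are x j - x i; squaring removes the sign.
  have hvand : (vandermonde x).det ^ 2 = (∏ i, ∏ j ∈ Finset.Ioi i, (x i - x j)) ^ 2 := by
    rw [det_vandermonde, ← Finset.prod_pow, ← Finset.prod_pow]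
    refine Finset.prod_congr rfl fun i _ => ?_
    rw [← Finset.prod_pow, ← Finset.prod_pow]
    exact Finset.prod_congr rfl fun j _ => by ring
  have hdet : ((altAntidiagonal n).map (Int.castRingHom R)).det = 1 := by
    rw [← RingHom.mapMatrix_apply, ← RingHom.map_det, det_altAntidiagonal heven, map_one]
  have hprod : ∏ a : Fin n, (foldedChoose n a : R) =
      ((∏ a ∈ Finset.range h, foldedChoose n a : ℕ) : R) ^ 2 := by
    rw [Fin.prod_univ_eq_prod_range (fun a => (foldedChoose n a : R)), ← Nat.cast_prod,
      ← Nat.cast_pow]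
    subst hn
    rw [prod_range_foldedChoose]
  rw [hmat, det_mul, det_mul, det_mul, det_mul, det_mul, det_transpose, det_diagonal,
    det_diagonal, hdet, hprod]
  linear_combination (∏ i, x i ^ 2) ^ 2 *
    ((∏ a ∈ Finset.range h, foldedChoose n a : ℕ) : R) ^ 2 * hvand

/-! ### Quadratic character of the half product -/

-- The denominators j!(n+3-j)!, for 4 ≤ j ≤ g+3 and n = 2g+4, run through 4!, …, (2g+3)! once each.
-- Pairing (2b+4)!(2b+5)! = (2b+4)!²(2b+5) leaves 5·7⋯(2g+3) = (2g+3)‼/3 modulo squares.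
open scoped Nat in
theorem prod_range_choose_mul_doubleFactorial (g : ℕ) :
    (∏ a ∈ Finset.range g, (2 * (g + 2) + 3).choose (a + 4)) *
        (∏ b ∈ Finset.range g, (2 * b + 4)!) ^ 2 * (2 * g + 3)‼ =
      3 * (2 * (g + 2) + 3)! ^ g := by
  have h1 : ∀ m : ℕ, (∏ b ∈ Finset.range m, (2 * b + 4)!) ^ 2 * (2 * m + 3)‼ =
      3 * ∏ a ∈ Finset.range (2 * m), (a + 4)! := by
    intro m
    induction m with
    | zero => rfl
    | succ m ih =>
      rw [Finset.prod_range_succ, show 2 * (m + 1) = 2 * m + 1 + 1 by ring,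
        Finset.prod_range_succ, Finset.prod_range_succ, ← mul_assoc, ← mul_assoc, ← ih,
        show 2 * m + 1 + 1 + 3 = 2 * m + 3 + 2 by ring, Nat.doubleFactorial_add_two,
        show 2 * m + 1 + 4 = (2 * m + 4) + 1 by ring, Nat.factorial_succ (2 * m + 4)]
      ring
  have h2 : ∏ a ∈ Finset.range (2 * g), (a + 4)! =
      ∏ a ∈ Finset.range g, ((a + 4)! * (2 * (g + 2) + 3 - (a + 4))!) := by
    rw [two_mul g, Finset.prod_range_add, Finset.prod_mul_distrib]
    congr 1
    rw [← Finset.prod_range_reflect]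
    refine Finset.prod_congr rfl fun a ha => ?_
    rw [Finset.mem_range] at ha
    congr 1
    omega
  rw [mul_assoc, h1, h2, mul_left_comm, ← Finset.prod_mul_distrib,
    Finset.prod_congr rfl (g := fun _ => (2 * (g + 2) + 3)!), Finset.prod_const, Finset.card_range]
  intro a ha
  rw [Finset.mem_range] at ha
  rw [← mul_assoc, Nat.choose_mul_factorial_mul_factorial (by omega)]

theorem foldedChoose_zero {n : ℕ} (hn : 4 ≤ n) :
    foldedChoose n 0 = (n + 3).choose 2 + (n + 3) := by
  rw [foldedChoose, Nat.choose_eq_zero_of_lt (show n + 3 < 2 * n + 1 - 0 by omega), add_zero,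
    zero_add, add_zero, Nat.choose_succ_self_right]

theorem foldedChoose_one {n : ℕ} (hn : 4 ≤ n) :
    foldedChoose n 1 = (n + 3).choose 3 + 1 := by
  rw [foldedChoose, Nat.choose_eq_zero_of_lt (show n + 3 < 2 * n + 1 - 1 by omega), add_zero,
    show n + 1 + 2 = n + 3 by ring, Nat.choose_self]

theorem foldedChoose_of_mem {n a : ℕ} (h2 : 2 ≤ a) (ha : a + 2 < n) :
    foldedChoose n a = (n + 3).choose (a + 2) := by
  rw [foldedChoose, Nat.choose_eq_zero_of_lt (show n + 3 < 2 * n + 1 - a by omega),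
    Nat.choose_eq_zero_of_lt (show n + 3 < n + a + 2 by omega), add_zero, add_zero]

theorem two_mul_foldedChoose_zero {n : ℕ} (hn : 4 ≤ n) :
    2 * foldedChoose n 0 = (n + 3) * (n + 4) := by
  have := Nat.add_one_mul_choose_eq (n + 2) 1
  rw [Nat.choose_one_right] at this
  rw [foldedChoose_zero hn]
  nlinarith

theorem six_mul_foldedChoose_one {n : ℕ} (hn : 4 ≤ n) :
    6 * foldedChoose n 1 = (n + 3) * (n + 2) * (n + 1) + 6 := by
  have h3 := Nat.add_one_mul_choose_eq (n + 2) 2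
  have h2 := Nat.add_one_mul_choose_eq (n + 1) 1
  rw [Nat.choose_one_right] at h2
  rw [foldedChoose_one hn]
  norm_num at h2 h3
  zify at h2 h3 ⊢
  linear_combination -(n + 3 : ℤ) * h2 - 2 * h3

theorem prod_range_foldedChoose_add_two (g : ℕ) :
    ∏ a ∈ Finset.range (g + 2), foldedChoose (2 * (g + 2)) a =
      (∏ a ∈ Finset.range g, (2 * (g + 2) + 3).choose (a + 4)) *
        foldedChoose (2 * (g + 2)) 1 * foldedChoose (2 * (g + 2)) 0 := by
  rw [Finset.prod_range_succ', Finset.prod_range_succ']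
  congr 2
  refine Finset.prod_congr rfl fun a ha => ?_
  rw [Finset.mem_range] at ha
  rw [foldedChoose_of_mem (by omega) (by omega)]

open scoped Nat in
/-- The quadratic character of half the product of the folded binomial coefficients,
when `k * n = -1` in the field. -/
theorem quadraticChar_prod_foldedChoose {p : ℕ} [Fact p.Prime] {g : ℕ}
    (hg : 2 * (g + 2) + 3 < p) {k : ZMod p} (hk : k * (2 * (g + 2) : ℕ) = -1) :
    quadraticChar (ZMod p) ((∏ a ∈ Finset.range (g + 2), foldedChoose (2 * (g + 2)) a : ℕ)) =
      quadraticChar (ZMod p) (k * (3 * k - 1) * (4 * k - 1) *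
        (6 * k ^ 3 + (3 * k - 1) * (2 * k - 1) * (k - 1))) *
      quadraticChar (ZMod p) (((2 * g + 3)‼ : ℕ) : ZMod p) *
      quadraticChar (ZMod p) (((2 * (g + 2) + 3)! : ℕ) : ZMod p) ^ g := by
  have hsmall : ∀ m : ℕ, 0 < m → m < p → (m : ZMod p) ≠ 0 := fun m h0 hm h =>
    absurd (Nat.le_of_dvd h0 ((ZMod.natCast_eq_zero_iff m p).mp h)) (by omega)
  have hfac : ∀ m : ℕ, m < p → ((m ! : ℕ) : ZMod p) ≠ 0 := fun m hm h =>
    absurd (((Fact.out : p.Prime).dvd_factorial).mp ((ZMod.natCast_eq_zero_iff _ p).mp h))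
      (by omega)
  have hk0 : k ≠ 0 := by
    rintro rfl
    simp at hk
  have hdf : (((2 * g + 3)‼ : ℕ) : ZMod p) ≠ 0 := by
    have := hfac (2 * g + 3) (by omega)
    rw [show 2 * g + 3 = (2 * g + 2) + 1 by ring, Nat.factorial_eq_mul_doubleFactorial,
      Nat.cast_mul] at this
    exact left_ne_zero_of_mul this
  have h2 : (2 : ZMod p) ≠ 0 := by exact_mod_cast hsmall 2 (by norm_num) (by omega)
  have h3 : (3 : ZMod p) ≠ 0 := by exact_mod_cast hsmall 3 (by norm_num) (by omega)
  set χ := quadraticChar (ZMod p) with hχ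
  have hsq : ∀ a : ZMod p, a ≠ 0 → χ a ^ 2 = 1 := fun a ha => quadraticChar_sq_one ha
  have hB := congrArg (fun m : ℕ => χ (m : ZMod p)) (prod_range_choose_mul_doubleFactorial g)
  have hG : ((∏ b ∈ Finset.range g, (2 * b + 4)! : ℕ) : ZMod p) ≠ 0 := by
    rw [Nat.cast_prod, Finset.prod_ne_zero_iff]
    intro b hb
    rw [Finset.mem_range] at hb
    exact hfac _ (by omega)
  -- The powers of k clear denominators, since k(n+j) = jk-1.
  have h0 := congrArg (fun m : ℕ => χ (k ^ 2 * (m : ZMod p)))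
    (two_mul_foldedChoose_zero (n := 2 * (g + 2)) (by omega))
  have h1 := congrArg (fun m : ℕ => χ (k ^ 3 * (m : ZMod p)))
    (six_mul_foldedChoose_one (n := 2 * (g + 2)) (by omega))
  rw [prod_range_foldedChoose_add_two]
  generalize (∏ a ∈ Finset.range g, (2 * (g + 2) + 3).choose (a + 4)) = B at *
  generalize (∏ b ∈ Finset.range g, (2 * b + 4)!) = G at *
  generalize foldedChoose (2 * (g + 2)) 0 = d0 at *
  generalize foldedChoose (2 * (g + 2)) 1 = d1 at *
  generalize (2 * (g + 2) + 3)! = N at *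
  generalize (2 * g + 3)‼ = D at *
  generalize 2 * (g + 2) = n at *
  have e0 : k ^ 2 * (((n + 3) * (n + 4) : ℕ) : ZMod p) = (3 * k - 1) * (4 * k - 1) := by
    push_cast
    linear_combination (k * (n + 3) + 4 * k - 1) * hk
  have e1 : k ^ 3 * (((n + 3) * (n + 2) * (n + 1) + 6 : ℕ) : ZMod p) =
      6 * k ^ 3 + (3 * k - 1) * (2 * k - 1) * (k - 1) := by
    have a1 : k * (n + 1) = k - 1 := by linear_combination hk
    have a2 : k * (n + 2) = 2 * k - 1 := by linear_combination hk
    have a3 : k * (n + 3) = 3 * k - 1 := by linear_combination hk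
    rw [← a1, ← a2, ← a3]
    push_cast
    ring
  simp only [e0] at h0
  simp only [e1] at h1
  rw [mul_assoc k, map_mul χ _ (6 * k ^ 3 + _), map_mul χ k, ← h1, ← h0]
  simp only [Nat.cast_mul, Nat.cast_pow, map_mul, map_pow, Nat.cast_ofNat] at hB ⊢
  have h6 : χ 6 = χ 2 * χ 3 := by rw [← map_mul]; norm_num
  rw [h6]
  have q2 := hsq 2 h2
  have q3 := hsq 3 h3
  have qk := hsq k hk0
  have qD := hsq _ hdf
  have qG := hsq _ hG
  have qk6 : χ k ^ 6 = 1 := by rw [show 6 = 2 * 3 by rfl, pow_mul, qk, one_pow]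
  rw [qG, mul_one] at hB
  have hB' : χ (B : ZMod p) = χ 3 * χ (D : ZMod p) * χ (N : ZMod p) ^ g := by
    linear_combination χ (D : ZMod p) * hB - χ (B : ZMod p) * qD
  rw [hB']
  generalize χ (d0 : ZMod p) = u
  generalize χ (d1 : ZMod p) = v
  generalize χ (D : ZMod p) = w
  generalize χ (N : ZMod p) ^ g = z
  -- The leading k completes k²·k³ to the square k⁶; 2·6 = 2²·3 matches the 3 coming from the
  -- binomials.
  linear_combination (-χ 3 * w * z * u * v) * qk6 - (χ 3 * w * z * u * v * χ k ^ 6) * q2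

/-! ### From roots of unity mod p to Legendre symbols -/

theorem pow_eq_one_of_isPowerResidue {p k n : ℕ} [Fact p.Prime] (hn : k * n = p - 1) {a : ℤ}
    (ha : IsPowerResidue k p a) : (a : ZMod p) ^ n = 1 := by
  obtain ⟨hc, y, hy⟩ := ha
  have hy' : (y : ZMod p) ^ k = a := by
    have := (ZMod.intCast_eq_intCast_iff _ _ p).mpr hy
    exact_mod_cast this
  have ha0 : (a : ZMod p) ≠ 0 := by
    intro h
    have hd := (ZMod.intCast_zmod_eq_zero_iff_dvd a p).mp h
    have := hc.isUnit_of_dvd' hd dvd_rfl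
    rw [Int.isUnit_iff] at this
    have := (Fact.out : p.Prime).one_lt
    omega
  have hk : k ≠ 0 := by
    rintro rfl
    have := (Fact.out : p.Prime).one_lt
    omega
  have hy0 : (y : ZMod p) ≠ 0 := by
    rintro h
    rw [h, zero_pow hk] at hy'
    exact ha0 hy'.symm
  rw [← hy', ← pow_mul, hn, ZMod.pow_card_sub_one_eq_one hy0]

theorem isSquare_residueDet {n k p : ℕ} (hn : Odd n) (α : Fin ((p - 1) / k) → ℤ) :
    IsSquare (residueDet n k (-1) p α) := by
  refine Int.isSquare_det_of_transpose_eq_neg _ ?_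
  ext i j
  simp only [Matrix.transpose_apply, Matrix.of_apply, Matrix.neg_apply]
  rw [← hn.neg_pow]
  ring

/-- When `-1` is a square modulo `p`, the Legendre symbol of the square root of the determinant is
that of the difference product times half the product of the folded binomial coefficients. -/
theorem legendreSym_sqrt_residueDet {p k h : ℕ} [Fact p.Prime] (hneg : IsSquare (-1 : ZMod p))
    (hn : (p - 1) / k = 2 * h) (hkn : k * (2 * h) = p - 1) (α : Fin ((p - 1) / k) → ℤ)
    (hα : ∀ i, IsPowerResidue k p (α i)) :
    legendreSym p (Int.sqrt (residueDet (3 + (p - 1) / k) k (-1) p α)) =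
      legendreSym p (residueDiffProd k p α) *
        quadraticChar (ZMod p) ((∏ a ∈ Finset.range h, foldedChoose (2 * h) a : ℕ)) := by
  have hsq : IsSquare (residueDet (3 + (p - 1) / k) k (-1) p α) :=
    isSquare_residueDet (by rw [hn]; exact ⟨h + 1, by ring⟩) α
  have hroots : ∀ i, ((α i : ℤ) : ZMod p) ^ ((p - 1) / k) = 1 := fun i =>
    pow_eq_one_of_isPowerResidue (hn ▸ hkn) (hα i)
  have hdet := det_sub_pow_add_three hn (fun i => ((α i : ℤ) : ZMod p)) hroots
  have hprod : ∏ a ∈ Finset.range h, foldedChoose ((p - 1) / k) a =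
      ∏ a ∈ Finset.range h, foldedChoose (2 * h) a := by rw [hn]
  have hcast : ((residueDet (3 + (p - 1) / k) k (-1) p α : ℤ) : ZMod p) =
      (Matrix.of fun i j =>
        (((α i : ℤ) : ZMod p) - ((α j : ℤ) : ZMod p)) ^ ((p - 1) / k + 3)).det := by
    rw [residueDet, Int.cast_det]
    congr 1
    ext i j
    simp only [Matrix.map_apply, Matrix.of_apply]
    push_cast
    rw [add_comm 3]
    ring
  set s := Int.sqrt (residueDet (3 + (p - 1) / k) k (-1) p α) with hs
  have hss : s * s = residueDet (3 + (p - 1) / k) k (-1) p α := by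
    obtain ⟨r, hr⟩ := hsq
    rw [hs, hr, Int.sqrt_eq, ← Int.natAbs_mul_self]
    simp
  have hT : ((residueDiffProd k p α : ℤ) : ZMod p) =
      ∏ i, ∏ j ∈ Finset.Ioi i, (((α i : ℤ) : ZMod p) - ((α j : ℤ) : ZMod p)) := by
    simp [residueDiffProd]
  rw [← hcast, ← hss, Int.cast_mul, ← sq, sq_eq_sq_iff_eq_or_eq_neg, ← hT, hprod] at hdet
  have hx : ∏ i, ((α i : ℤ) : ZMod p) ≠ 0 := by
    rw [Finset.prod_ne_zero_iff]
    intro i _ h0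
    have := hroots i
    rw [h0, zero_pow (Fin.pos i).ne'] at this
    exact zero_ne_one this
  have hneg1 : quadraticChar (ZMod p) (-1) = 1 :=
    (quadraticChar_one_iff_isSquare (neg_ne_zero.mpr one_ne_zero)).mpr hneg
  have hval : quadraticChar (ZMod p) (s : ZMod p) =
      quadraticChar (ZMod p) ((∏ i, (α i : ZMod p) ^ 2) * ((residueDiffProd k p α : ℤ) : ZMod p) *
        ((∏ a ∈ Finset.range h, foldedChoose (2 * h) a : ℕ) : ZMod p)) := by
    rcases hdet with h | h
    · rw [h]
    · rw [h, ← neg_one_mul, map_mul, hneg1, one_mul]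
  rw [legendreSym, hval, map_mul, map_mul, Finset.prod_pow, quadraticChar_sq_one' hx, one_mul]
  rfl

/-- The determinant is a perfect square, so that `Int.sqrt` is its exact nonnegative square root,
and the Legendre symbol of this root is evaluated. -/
theorem theorem1p4 (p k : ℕ) [Fact p.Prime] (hp : p ≠ 2) (hk : 2 ≤ k) (hkp : k ≤ (p - 1) / 2)
    (hmod : p ≡ 1 [MOD 2 * k]) (α : Fin ((p - 1) / k) → ℤ) (hα : IsResidueSystem k p α) :
    IsSquare (residueDet (3 + (p - 1) / k) k (-1) p α) ∧
    (p ≡ 1 [MOD 4 * k] →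
      legendreSym p (Int.sqrt (residueDet (3 + (p - 1) / k) k (-1) p α)) =
        legendreSym p ((k : ℤ) * (3 * k - 1) * (4 * k - 1) *
            (6 * (k : ℤ) ^ 3 + (3 * k - 1) * (2 * k - 1) * (k - 1))) *
          legendreSym p (Nat.doubleFactorial ((p - 1) / k - 1) : ℤ) *
          legendreSym p (residueDiffProd k p α)) ∧
    (Even k → p ≡ 2 * k + 1 [MOD 4 * k] →
      legendreSym p (Int.sqrt (residueDet (3 + (p - 1) / k) k (-1) p α)) =
        if p = 2 * k + 1 then legendreSym p (residueDiffProd k p α)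
        else
          legendreSym p (((k : ℤ) - 1) * (2 * k - 1) * (4 * k - 1) *
              (6 * (k : ℤ) ^ 3 + (3 * k - 1) * (2 * k - 1) * (k - 1))) *
            legendreSym p (Nat.doubleFactorial ((p - 1) / k) : ℤ) *
            legendreSym p (residueDiffProd k p α)) := by
  have hp1 := (Fact.out : p.Prime).one_lt
  obtain ⟨h, hh⟩ : 2 * k ∣ p - 1 := (Nat.modEq_iff_dvd' hp1.le).mp hmod.symm
  have hn : (p - 1) / k = 2 * h := by
    rw [hh, show 2 * k * h = k * (2 * h) by ring, Nat.mul_div_cancel_left _ (by omega)]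
  have hkn : k * (2 * h) = p - 1 := by rw [hh]; ring
  have hpos : 0 < h := by
    rcases Nat.eq_zero_or_pos h with rfl | h0
    · omega
    · exact h0
  -- Since k ≥ 2; once h ≥ 2 this gives n+3 < p, so the factorials involved are units mod p.
  have hbig : 4 * h + 1 ≤ p := by
    have := Nat.mul_le_mul_right (2 * h) hk
    omega
  have hk' : (k : ZMod p) * (2 * h : ℕ) = -1 := by
    rw [← Nat.cast_mul, hkn, Nat.cast_sub hp1.le]
    simp
  refine ⟨isSquare_residueDet (by rw [hn]; exact ⟨h + 1, by ring⟩) α, fun h4 => ?_, fun hke h4 => ?_⟩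
  · obtain ⟨r, hr⟩ : 4 * k ∣ p - 1 := (Nat.modEq_iff_dvd' hp1.le).mp h4.symm
    have hhr : h = 2 * r := by
      have : k * h = k * (2 * r) := by linarith
      exact Nat.eq_of_mul_eq_mul_left (by omega) this
    have hneg : IsSquare (-1 : ZMod p) := by
      rw [ZMod.exists_sq_eq_neg_one_iff]
      have : p - 1 = 4 * (k * r) := by rw [hr]; ring
      omega
    obtain ⟨g, rfl⟩ : ∃ g, h = g + 2 := ⟨h - 2, by omega⟩
    have hge : Even g := ⟨r - 1, by omega⟩
    have hN : ((Nat.factorial (2 * (g + 2) + 3) : ℕ) : ZMod p) ≠ 0 := fun h0 =>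
      absurd (((Fact.out : p.Prime).dvd_factorial).mp ((ZMod.natCast_eq_zero_iff _ p).mp h0))
        (by omega)
    -- Here g = h-2 is even, so (n+3)! drops out; in case (b) g is odd and one copy survives.
    have hNg : quadraticChar (ZMod p) ((Nat.factorial (2 * (g + 2) + 3) : ℕ) : ZMod p) ^ g = 1 := by
      obtain ⟨t, ht⟩ := hge.two_dvd
      rw [show ∀ c : ℤ, c ^ g = (c ^ 2) ^ t from fun c => by rw [← pow_mul, ← ht], quadraticChar_sq_one hN, one_pow]
    rw [legendreSym_sqrt_residueDet hneg hn hkn α hα.1,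
      quadraticChar_prod_foldedChoose (by omega) hk', hNg, mul_one, mul_comm, hn,
      show 2 * (g + 2) - 1 = 2 * g + 3 by omega]
    congr 2
    · rw [legendreSym]
      push_cast
      rfl
    · rw [legendreSym]
      push_cast
      rfl
  · obtain ⟨r, hr⟩ : ∃ r, h = 2 * r + 1 := by
      rcases Nat.even_or_odd' h with ⟨r, rfl | rfl⟩
      · exfalso
        have h5 : 2 * k + 1 ≡ 0 + 1 [MOD 4 * k] := by
          refine h4.symm.trans ((Nat.modEq_iff_dvd' hp1.le).mpr ⟨r, ?_⟩).symm
          rw [hh]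
          ring
        have h6 := Nat.le_of_dvd (by omega)
          ((Nat.modEq_zero_iff_dvd).mp (Nat.ModEq.add_right_cancel' 1 h5))
        omega
      · exact ⟨r, rfl⟩
    have hneg : IsSquare (-1 : ZMod p) := by
      rw [ZMod.exists_sq_eq_neg_one_iff]
      obtain ⟨t, rfl⟩ := hke
      have : p - 1 = 4 * (t * h) := by rw [hh]; ring
      omega
    rw [legendreSym_sqrt_residueDet hneg hn hkn α hα.1]
    by_cases hp2 : p = 2 * k + 1
    · have h1 : h = 1 := by
        have : 2 * k * h = 2 * k * 1 := by omega
        exact Nat.eq_of_mul_eq_mul_left (by omega) this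
      subst h1
      rw [if_pos hp2]
      have h2 : (4 : ZMod p) ≠ 0 := by
        intro h0
        have h0' : ((4 : ℕ) : ZMod p) = 0 := by exact_mod_cast h0
        have := Nat.le_of_dvd (by norm_num) ((ZMod.natCast_eq_zero_iff _ p).mp h0')
        omega
      -- For n = 2 all three binomials overlap: 10 + 5 + 1 = 16.
      have h16 : ((∏ a ∈ Finset.range 1, foldedChoose (2 * 1) a : ℕ) : ZMod p) = 4 ^ 2 := by
        simp [foldedChoose, Nat.choose]
        norm_num
      rw [h16, quadraticChar_sq_one' h2, mul_one]
    · rw [if_neg hp2]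
      have hr1 : r ≠ 0 := by
        rintro rfl
        subst hr
        omega
      obtain ⟨g, rfl⟩ : ∃ g, h = g + 2 := ⟨h - 2, by omega⟩
      have hsmall : ∀ m : ℕ, 0 < m → m < p → (m : ZMod p) ≠ 0 := fun m h0 hm h =>
        absurd (Nat.le_of_dvd h0 ((ZMod.natCast_eq_zero_iff m p).mp h)) (by omega)
      have hfac : ∀ m : ℕ, m < p → ((Nat.factorial m : ℕ) : ZMod p) ≠ 0 := fun m hm h0 =>
        absurd (((Fact.out : p.Prime).dvd_factorial).mp ((ZMod.natCast_eq_zero_iff _ p).mp h0))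
          (by omega)
      rw [quadraticChar_prod_foldedChoose (by omega) hk', hn, show 2 * (g + 2) = 2 * g + 4 by ring]
      rw [show 2 * (g + 2) = 2 * g + 4 by ring] at hk'
      obtain ⟨t, rfl⟩ : ∃ t, g = 2 * t + 1 := ⟨r - 1, by omega⟩
      have hN : quadraticChar (ZMod p)
          ((Nat.factorial (2 * (2 * t + 1) + 4 + 3) : ℕ) : ZMod p) ^ (2 * t + 1) =
          quadraticChar (ZMod p) ((Nat.factorial (2 * (2 * t + 1) + 4 + 3) : ℕ) : ZMod p) := by
        rw [pow_succ, pow_mul, quadraticChar_sq_one (hfac _ (by omega)), one_pow, one_mul]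
      rw [hN]
      generalize 2 * t + 1 = g at *
      have hdf : ((Nat.doubleFactorial (2 * g + 3) : ℕ) : ZMod p) ≠ 0 := by
        have := hfac (2 * g + 3) (by omega)
        rw [show 2 * g + 3 = (2 * g + 2) + 1 by ring, Nat.factorial_eq_mul_doubleFactorial,
          Nat.cast_mul] at this
        exact left_ne_zero_of_mul this
      have hk0 : (k : ZMod p) ≠ 0 := by
        intro h0
        rw [h0] at hk'
        simp at hk'
      have a1 : (k : ZMod p) * (2 * g + 5) = k - 1 := by
        push_cast at hk'
        linear_combination hk'
      have a2 : (k : ZMod p) * (2 * g + 6) = 2 * k - 1 := by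
        push_cast at hk'
        linear_combination hk'
      have a3 : (k : ZMod p) * (2 * g + 7) = 3 * k - 1 := by
        push_cast at hk'
        linear_combination hk'
      have hk3 : (3 * k - 1 : ZMod p) ≠ 0 := by
        rw [← a3]
        refine mul_ne_zero hk0 ?_
        exact_mod_cast hsmall (2 * g + 7) (by omega) (by omega)
      -- From (n+3)! = (n+1)(n+2)(n+3)·n‼·(n-1)‼: modulo squares, the surviving (n+3)! trades
      -- k(3k-1)(n-1)‼ for (k-1)(2k-1)n‼.
      have hfact : (k : ZMod p) ^ 3 * ((Nat.factorial (2 * g + 4 + 3) : ℕ) : ZMod p) =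
          (k - 1) * (2 * k - 1) * (3 * k - 1) *
            ((Nat.doubleFactorial (2 * g + 4) : ℕ) : ZMod p) *
            ((Nat.doubleFactorial (2 * g + 3) : ℕ) : ZMod p) := by
        rw [← a1, ← a2, ← a3, Nat.factorial_succ, Nat.factorial_succ, Nat.factorial_succ,
          show 2 * g + 4 = (2 * g + 3) + 1 by ring, Nat.factorial_eq_mul_doubleFactorial]
        push_cast
        ring
      have hχ := congrArg (quadraticChar (ZMod p)) hfact
      have q3 := quadraticChar_sq_one (F := ZMod p) hk3
      have qk := quadraticChar_sq_one (F := ZMod p) hk0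
      have qD := quadraticChar_sq_one (F := ZMod p) hdf
      simp only [legendreSym]
      push_cast
      simp only [map_mul, map_pow] at hχ ⊢
      generalize quadraticChar (ZMod p) (Nat.factorial (2 * g + 4 + 3) : ZMod p) = N at *
      generalize quadraticChar (ZMod p) (Nat.doubleFactorial (2 * g + 4) : ZMod p) = E at *
      generalize quadraticChar (ZMod p) (Nat.doubleFactorial (2 * g + 3) : ZMod p) = D at *
      generalize quadraticChar (ZMod p) (k : ZMod p) = c at *
      generalize quadraticChar (ZMod p) (3 * k - 1 : ZMod p) = c3 at *
      generalize quadraticChar (ZMod p) (residueDiffProd k p α : ZMod p) = T at *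
      generalize quadraticChar (ZMod p) (6 * (k : ZMod p) ^ 3 + _) = Q at *
      generalize quadraticChar (ZMod p) (2 * k - 1 : ZMod p) = c2 at *
      generalize quadraticChar (ZMod p) (4 * k - 1 : ZMod p) = c4 at *
      generalize quadraticChar (ZMod p) (k - 1 : ZMod p) = c1 at *
      have hN' : c * N = c1 * c2 * c3 * E * D := by
        linear_combination hχ - c * N * qk
      linear_combination T * c3 * c4 * Q * D * hN' + T * c4 * Q * c1 * c2 * E * c3 ^ 2 * qD +
        T * c4 * Q * c1 * c2 * E * q3
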